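/- Call an action of a group $\Gamma$ on a set $X$ amenable if there is a finitely additive $\Gamma$-invariant probability measure defined on all subsets of $X$. A group $\Gamma$ is amenable if its action on itself by left multiplication is amenable, and inner amenable if its action on $\Gamma\setminus\{e\}$ by conjugation is amenable. A group is ICC if all its nontrivial conjugacy classes are infinite. Two groups are elementarily equivalent if they satisfy the same first-order sentences in the language of groups. There exist elementarily equivalent countable ICC groups $G$ and $H$ such that $G$ is amenable and $H$ is not inner amenable. Concretely, let $K=\mathbb F_2^{\mathrm{alg}}$ be the algebraic closure of the field with two elements. Then $\operatorname{SL}_2(K)$ is a countable amenable ICC group. For every algebraically closed field $L$ of characteristic $2$ and positive transcendence degree over $\mathbb F_2$, the group $\operatorname{SL}_2(L)$ is ICC, is elementarily equivalent to $\operatorname{SL}_2(K)$, and is not inner amenable; if $L$ is countable, then so is $\operatorname{SL}_2(L)$. The field $L=\mathbb F_2(t)^{\mathrm{alg}}$, where $t$ is an indeterminate, is countable, algebraically closed, of characteristic $2$ and of positive transcendence degree over $\mathbb F_2$, so that $G=\operatorname{SL}_2(K)$ and $H=\operatorname{SL}_2(\mathbb F_2(t)^{\mathrm{alg}})$ are groups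 as required. -/

import Mathlib

open Set
open scoped NNReal FirstOrder MatrixGroups

/-- The function symbols of the language of groups: multiplication, inversion and the identity. -/
inductive GroupFunc : ℕ → Type
  | mul : GroupFunc 2
  | inv : GroupFunc 1
  | one : GroupFunc 0

/-- The first-order language of groups `(·, ⁻¹, 1)`. -/
def groupLanguage : FirstOrder.Language where
  Functions := GroupFunc
  Relations := fun _ => Empty

/-- Every group is a structure in the language of groups, with the usual interpretation. -/
instance groupStructure (G : Type*) [Group G] : groupLanguage.Structure G where
  funMap := fun {n} (f : GroupFunc n) =>
    match n, f with
    | _, .mul => fun x => x 0 * x 1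
    | _, .inv => fun x => (x 0)⁻¹
    | _, .one => fun _ => 1
  RelMap := fun r => nomatch r

/-- An action of `G` on `X` is amenable if there is a finitely additive `G`-invariant probability
measure defined on all subsets of `X`. -/
def IsAmenableAction (G X : Type*) [Group G] [MulAction G X] : Prop :=
  ∃ μ : Set X → ℝ≥0, μ univ = 1 ∧
    (∀ A B : Set X, Disjoint A B → μ (A ∪ B) = μ A + μ B) ∧
    ∀ (g : G) (A : Set X), μ ((fun x => g • x) '' A) = μ A

/-- A group is amenable if its action on itself by left multiplication is amenable. -/
def IsAmenable (G : Type*) [Group G] : Prop :=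
  IsAmenableAction G G

/-- The set `G \ {1}` with the conjugation action of `G`. -/
def nontrivialElements (G : Type*) [Group G] : SubMulAction (ConjAct G) G where
  carrier := {1}ᶜ
  smul_mem' := by
    intro c x hx
    simpa [ConjAct.smul_def, mul_inv_eq_one] using hx

/-- A group is inner amenable if its action by conjugation on `G \ {1}` is amenable. -/
def IsInnerAmenable (G : Type*) [Group G] : Prop :=
  IsAmenableAction (ConjAct G) (nontrivialElements G)

/-- A group is ICC if all its nontrivial conjugacy classes are infinite. -/
def IsICC (G : Type*) [Group G] : Prop :=
  ∀ g : G, g ≠ 1 → (conjugatesOf g).Infinite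

/-!
`SL(n, R)` is interpreted in the ring `R` by first-order formulas that do not depend on `R`, so
completeness of the theory of algebraically closed fields of a given characteristic passes to
elementary equivalence of the groups. The group `SL(2, K)` for `K` algebraic over a finite field is
locally finite, hence amenable. An element with finitely many conjugates commutes with a nontrivial
transvection for each pair of indices, so it is central, and in characteristic two the centre of
`SL(2, K)` is trivial.

If `L` is algebraically closed, every element of `SL(2, L)` has a fixed point on the projective
line, and a noncentral one has at most two. If `L` is transcendental over its prime field, it
carries a valuation `v` with `1 < v t` for some `t`. For a mean invariant under conjugation, the
expansion `z ↦ t² z` shows that almost every element fixes a point of the disc `v z < 1` or of the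
disc `1 < v z` about infinity. The translations by elements of `𝔽₄` preserve the second disc and
move the first one to four disjoint discs. They cannot all contain fixed points of the same
element, so almost every element fixes a point of the disc about infinity. By inversion it then
fixes a point of the unit disc, and by translation one in each of the four discs: a contradiction.
-/

section Interpretation

open FirstOrder FirstOrder.Language FirstOrder.Ring Matrix

variable {α n : Type*} [Fintype n] [DecidableEq n] {R S : Type*} [CommRing R] [CommRing S]

/-- The value of a group term at generic matrices: the variable `(a, i, j)` stands for the
`(i, j)` entry of the matrix substituted for `a`. Inverses become adjugates, so that the entries
remain polynomials. -/
noncomputable def genericValue :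
    groupLanguage.Term α → Matrix n n (FreeCommRing (α × n × n))
  | .var a => .of fun i j => .of (a, i, j)
  | .func .mul ts => genericValue (ts 0) * genericValue (ts 1)
  | .func .inv ts => (genericValue (ts 0)).adjugate
  | .func .one _ => 1

/-- The ring formula asserting that two integer polynomials take the same value. -/
noncomputable def polynomialEq (p q : FreeCommRing α) : Language.ring.Formula α :=
  (termOfFreeCommRing p).equal (termOfFreeCommRing q)

/-- The ring formula asserting that a matrix of variables has determinant one. -/
noncomputable def detEqOne (α n : Type*) [Fintype n] [DecidableEq n] :
    Language.ring.Formula (α ⊕ n × n) :=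
  polynomialEq (det (.of fun i j => .of (.inr (i, j)))) 1

/-- Separates the entries of the last bound matrix variable from those of the others. -/
def separateLast {k : ℕ} : (α ⊕ Fin (k + 1)) × n × n → (α ⊕ Fin k) × n × n ⊕ n × n
  | (.inl a, ij) => .inl (.inl a, ij)
  | (.inr l, ij) => Fin.lastCases (.inr ij) (fun l => .inl (.inr l, ij)) l

/-- The translation of a formula about `SL(n, R)` into a formula about the ring `R`: a quantifier
over group elements becomes a block of quantifiers over the entries of a matrix of determinant
one. -/
noncomputable def ringFormula : {k : ℕ} → groupLanguage.BoundedFormula α k →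
    Language.ring.Formula ((α ⊕ Fin k) × n × n)
  | _, .falsum => ⊥
  | _, .equal t s => .iInf fun ij : n × n =>
      polynomialEq (genericValue t ij.1 ij.2) (genericValue s ij.1 ij.2)
  | _, .rel r _ => nomatch r
  | _, .imp φ ψ => (ringFormula φ).imp (ringFormula ψ)
  | k, .all φ => .iAlls (n × n)
      ((detEqOne ((α ⊕ Fin k) × n × n) n).imp ((ringFormula φ).relabel separateLast))

/-- The assignment of matrix entries to ring variables that corresponds to an assignment of
matrices to group variables. -/
def entries (v : α → Matrix.SpecialLinearGroup n R) : α × n × n → R :=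
  fun a => v a.1 a.2.1 a.2.2

theorem map_lift_entries_genericValue (v : α → Matrix.SpecialLinearGroup n R)
    (t : groupLanguage.Term α) :
    (FreeCommRing.lift (entries v)).mapMatrix (genericValue t) = (t.realize v).1 := by
  induction t with
  | var a => ext i j; simp [genericValue, entries]
  | func f ts ih =>
    cases f with
    | mul => rw [genericValue, map_mul, ih, ih]; rfl
    | inv => rw [genericValue, RingHom.map_adjugate, ih]; rfl
    | one => rw [genericValue, map_one]; rfl

theorem lift_entries_genericValue_apply (v : α → Matrix.SpecialLinearGroup n R)
    (t : groupLanguage.Term α) (i j : n) :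
    FreeCommRing.lift (entries v) (genericValue t i j) = t.realize v i j :=
  congrFun₂ (map_lift_entries_genericValue v t) i j

theorem sumElim_entries_comp_separateLast {k : ℕ} (v : α → Matrix.SpecialLinearGroup n R)
    (w : Fin k → Matrix.SpecialLinearGroup n R) (g : Matrix.SpecialLinearGroup n R) :
    Sum.elim (entries (Sum.elim v w)) (fun ij => g ij.1 ij.2) ∘ separateLast =
      entries (Sum.elim v (Fin.snoc w g)) := by
  funext ⟨a, ij⟩
  rcases a with a | l
  · rfl
  · cases l using Fin.lastCases <;> simp [separateLast, entries]

variable [CompatibleRing R] [CompatibleRing S]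

theorem realize_polynomialEq (p q : FreeCommRing α) (v : α → R) :
    (polynomialEq p q).Realize v ↔ FreeCommRing.lift v p = FreeCommRing.lift v q := by
  simp only [polynomialEq, Formula.realize_equal, realize_termOfFreeCommRing]

theorem realize_detEqOne (v : α → R) (m : n × n → R) :
    (detEqOne α n).Realize (Sum.elim v m) ↔ det (.of fun i j => m (i, j)) = 1 := by
  rw [detEqOne, realize_polynomialEq, RingHom.map_det, map_one]
  congr! 2
  ext i j
  simp

theorem realize_ringFormula {k : ℕ} (φ : groupLanguage.BoundedFormula α k)
    (v : α → Matrix.SpecialLinearGroup n R) (w : Fin k → Matrix.SpecialLinearGroup n R) :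
    (ringFormula φ).Realize (entries (Sum.elim v w)) ↔ φ.Realize v w := by
  induction φ with
  | falsum => rfl
  | equal t s =>
    simp only [ringFormula, Formula.realize_iInf, realize_polynomialEq,
      lift_entries_genericValue_apply, Prod.forall, BoundedFormula.Realize]
    exact (Matrix.SpecialLinearGroup.ext_iff _ _).symm
  | rel r => exact nomatch r
  | imp φ ψ ihφ ihψ =>
    simp only [ringFormula, Formula.realize_imp, ihφ, ihψ, BoundedFormula.realize_imp]
  | all φ ih =>
    simp only [ringFormula, Formula.realize_iAlls, Formula.realize_imp, Formula.realize_relabel,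
      BoundedFormula.realize_all, realize_detEqOne]
    constructor
    · intro h g
      rw [← ih, ← sumElim_entries_comp_separateLast]
      exact h _ g.2
    · intro h m hm
      let g : Matrix.SpecialLinearGroup n R := ⟨.of fun i j => m (i, j), hm⟩
      have hg := h g
      rw [← ih, ← sumElim_entries_comp_separateLast] at hg
      exact hg

variable (n) in
/-- The translation of a sentence about `SL(n, R)` into a sentence about the ring `R`. -/
noncomputable def ringSentence (φ : groupLanguage.Sentence) : Language.ring.Sentence :=
  (ringFormula (n := n) φ).relabel fun a => a.1.elim id Fin.elim0

variable (n R) in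
theorem realize_ringSentence (φ : groupLanguage.Sentence) :
    R ⊨ ringSentence n φ ↔ Matrix.SpecialLinearGroup n R ⊨ φ := by
  rw [Sentence.Realize, ringSentence, Formula.realize_relabel]
  refine .trans (iff_of_eq ?_) (realize_ringFormula (n := n) (R := R) φ _ _)
  exact congrArg (ringFormula φ).Realize (funext fun a => a.1.elim Empty.elim Fin.elim0)

variable (n) in
theorem elementarilyEquivalent_specialLinearGroup (h : R ≅[Language.ring] S) :
    Matrix.SpecialLinearGroup n R ≅[groupLanguage] Matrix.SpecialLinearGroup n S := by
  rw [elementarilyEquivalent_iff] at h ⊢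
  intro φ
  rw [← realize_ringSentence, h, realize_ringSentence]

end Interpretation

open FirstOrder FirstOrder.Language FirstOrder.Ring in
theorem elementarilyEquivalent_of_isAlgClosed {p : ℕ} (hp : p.Prime ∨ p = 0) (K L : Type*)
    [Field K] [Field L] [IsAlgClosed K] [IsAlgClosed L] [CharP K p] [CharP L p] [CompatibleRing K]
    [CompatibleRing L] : K ≅[Language.ring] L := by
  rw [elementarilyEquivalent_iff]
  intro φ
  have hc := Field.ACF_isComplete hp
  rw [hc.realize_sentence_iff, hc.realize_sentence_iff]

theorem elementarilyEquivalent_specialLinearGroup_of_isAlgClosed (n : Type*) [Fintype n]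
    [DecidableEq n] {p : ℕ} (hp : p.Prime ∨ p = 0) (K L : Type*) [Field K] [Field L]
    [IsAlgClosed K] [IsAlgClosed L] [CharP K p] [CharP L p] :
    Matrix.SpecialLinearGroup n K ≅[groupLanguage] Matrix.SpecialLinearGroup n L :=
  letI := FirstOrder.Ring.compatibleRingOfRing K
  letI := FirstOrder.Ring.compatibleRingOfRing L
  elementarilyEquivalent_specialLinearGroup n (elementarilyEquivalent_of_isAlgClosed hp K L)

section Center

open Matrix Matrix.SpecialLinearGroup

variable {n R : Type*} [Fintype n] [DecidableEq n] [CommRing R]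

theorem commute_single_one_of_commute_transvection [NoZeroDivisors R] {i j : n} {a : R}
    (ha : a ≠ 0) {M : Matrix n n R} (h : Commute (Matrix.transvection i j a) M) :
    Commute (single i j 1) M := by
  have hsingle : Commute (a • single i j 1) M := by
    rw [smul_single, smul_eq_mul, mul_one, ← add_sub_cancel_left 1 (single i j a)]
    exact h.sub_left (Commute.one_left M)
  refine smul_right_injective _ ha ?_
  simpa only [smul_mul_assoc, mul_smul_comm] using hsingle.eq

theorem exists_commute_transvection_of_finite_conjugatesOf [Infinite R]
    {g : Matrix.SpecialLinearGroup n R} (hg : (conjugatesOf g).Finite) {i j : n} (hij : i ≠ j) :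
    ∃ a : R, a ≠ 0 ∧ Commute (transvection hij a) g := by
  obtain ⟨b, -, c, -, hbc, h⟩ := infinite_univ.exists_ne_map_eq_of_mapsTo
    (f := fun a : R => transvection hij a * g * (transvection hij a)⁻¹)
    (fun a _ => isConj_iff.2 ⟨transvection hij a, rfl⟩) hg
  refine ⟨-c + b, by rwa [ne_eq, neg_add_eq_zero, eq_comm], ?_⟩
  rw [transvection_add, ← transvection_inv, commute_iff_eq]
  rw [mul_inv_eq_iff_eq_mul] at h
  rw [mul_assoc, inv_mul_eq_iff_eq_mul, h]
  simp only [mul_assoc]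

theorem mem_center_specialLinearGroup_iff_mem_range_scalar {g : Matrix.SpecialLinearGroup n R} :
    g ∈ Subgroup.center (Matrix.SpecialLinearGroup n R) ↔ g.1 ∈ range (scalar n) := by
  refine Matrix.SpecialLinearGroup.mem_center_iff.trans ⟨fun ⟨r, _, hr⟩ => ⟨r, hr⟩, ?_⟩
  rintro ⟨r, hr⟩
  exact ⟨r, by simpa [← hr, scalar_apply, det_diagonal] using g.det_coe, hr⟩

theorem infinite_conjugatesOf_of_notMem_center [Infinite R] [NoZeroDivisors R]
    {g : Matrix.SpecialLinearGroup n R} (hg : g ∉ Subgroup.center (Matrix.SpecialLinearGroup n R)) :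
    (conjugatesOf g).Infinite := by
  contrapose! hg
  have hcomm : Pairwise fun i j => Commute (single i j 1) g.1 := fun i j hij =>
    have ⟨_, ha, h⟩ := exists_commute_transvection_of_finite_conjugatesOf hg hij
    commute_single_one_of_commute_transvection ha (congrArg Subtype.val h)
  exact mem_center_specialLinearGroup_iff_mem_range_scalar.2
    (mem_range_scalar_of_commute_single hcomm)

theorem center_specialLinearGroup_eq_bot (p k : ℕ) [ExpChar R p] [IsReduced R]
    (hn : Fintype.card n = p ^ k) : Subgroup.center (Matrix.SpecialLinearGroup n R) = ⊥ := by
  rw [eq_bot_iff]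
  intro g hg
  obtain ⟨r, hr, hrg⟩ := Matrix.SpecialLinearGroup.mem_center_iff.1 hg
  have hr1 : r = 1 := by
    simpa [hn] using (ExpChar.pow_prime_pow_mul_eq_one_iff p k 1 r).1 (by rwa [mul_one, ← hn])
  exact Subtype.ext (by rw [← hrg, hr1, map_one]; rfl)

theorem isICC_specialLinearGroup [Infinite R] [NoZeroDivisors R]
    (h : Subgroup.center (Matrix.SpecialLinearGroup n R) = ⊥) :
    IsICC (Matrix.SpecialLinearGroup n R) :=
  fun _ hg => infinite_conjugatesOf_of_notMem_center (by rwa [h, Subgroup.mem_bot])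

end Center

section Mean

open Filter Topology
open scoped Pointwise

variable {ι G X Y : Type*} {μ : Set X → ℝ≥0}

/-- A mean on `X`: a finitely additive probability measure defined on all subsets. -/
structure IsMean (μ : Set X → ℝ≥0) : Prop where
  univ : μ univ = 1
  union : ∀ A B, Disjoint A B → μ (A ∪ B) = μ A + μ B

/-- A mean invariant under an action of `G`, as in the definition of `IsAmenableAction`. -/
structure IsInvariantMean (G : Type*) [Group G] [MulAction G X] (μ : Set X → ℝ≥0) : Prop
    extends IsMean μ where
  smul : ∀ (g : G) (A : Set X), μ (g • A) = μ A

theorem isAmenableAction_iff_exists_isInvariantMean [Group G] [MulAction G X] :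
    IsAmenableAction G X ↔ ∃ μ : Set X → ℝ≥0, IsInvariantMean G μ :=
  ⟨fun ⟨μ, huniv, hunion, hsmul⟩ => ⟨μ, ⟨huniv, hunion⟩, hsmul⟩,
    fun ⟨μ, hμ⟩ => ⟨μ, hμ.univ, hμ.union, hμ.smul⟩⟩

theorem IsMean.mono (hμ : IsMean μ) {A B : Set X} (h : A ⊆ B) : μ A ≤ μ B := by
  rw [← union_sdiff_cancel h, hμ.union _ _ disjoint_sdiff_right]
  exact le_self_add

theorem IsMean.le_one (hμ : IsMean μ) (A : Set X) : μ A ≤ 1 :=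
  hμ.univ ▸ hμ.mono (subset_univ A)

theorem IsMean.map (hμ : IsMean μ) (f : X → Y) : IsMean fun A => μ (f ⁻¹' A) where
  univ := hμ.univ
  union _ _ h := hμ.union _ _ (h.preimage f)

theorem isMean_ncard_div_card [Finite X] [Nonempty X] :
    IsMean fun A : Set X => (A.ncard / Nat.card X : ℝ≥0) where
  univ := by rw [ncard_univ, div_self (Nat.cast_ne_zero.2 Nat.card_pos.ne')]
  union A B h := by rw [ncard_union_eq h, Nat.cast_add, add_div]

theorem exists_isMean_forall_tendsto (l : Ultrafilter ι) {m : ι → Set X → ℝ≥0}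
    (hm : ∀ i, IsMean (m i)) :
    ∃ μ : Set X → ℝ≥0, IsMean μ ∧ ∀ A, Tendsto (fun i => m i A) l (𝓝 (μ A)) := by
  have hlim : ∀ A, ∃ x, Tendsto (fun i => m i A) l (𝓝 x) := fun A =>
    have hmem : Icc 0 1 ∈ l.map (m · A) :=
      mem_map.2 <| univ_mem' fun i => ⟨zero_le, (hm i).le_one A⟩
    have ⟨x, _, hx⟩ := isCompact_Icc.ultrafilter_le_nhds _ (le_principal_iff.2 hmem)
    ⟨x, hx⟩
  choose μ hμ using hlim
  refine ⟨μ, ⟨?_, fun A B hAB => ?_⟩, hμ⟩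
  · exact tendsto_nhds_unique (hμ univ) (tendsto_const_nhds.congr fun i => (hm i).univ.symm)
  · exact tendsto_nhds_unique (hμ (A ∪ B))
      (((hμ A).add (hμ B)).congr fun i => ((hm i).union A B hAB).symm)

theorem isAmenableAction_of_eventually_invariant [Group G] [MulAction G X] (l : Filter ι)
    [l.NeBot] {m : ι → Set X → ℝ≥0} (hm : ∀ i, IsMean (m i))
    (hinv : ∀ (g : G) (A : Set X), ∀ᶠ i in l, m i (g • A) = m i A) : IsAmenableAction G X := by
  obtain ⟨μ, hμ, hlim⟩ := exists_isMean_forall_tendsto (Ultrafilter.of l) hm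
  refine isAmenableAction_iff_exists_isInvariantMean.2 ⟨μ, hμ, fun g A => ?_⟩
  have heq : (fun i => m i (g • A)) =ᶠ[Ultrafilter.of l] fun i => m i A :=
    Ultrafilter.of_le l (hinv g A)
  exact tendsto_nhds_unique ((hlim _).congr' heq) (hlim A)

theorem isAmenable_of_finite [Group G] [Finite G] : IsAmenable G :=
  isAmenableAction_iff_exists_isInvariantMean.2 ⟨_, isMean_ncard_div_card, fun g A => by
    rw [ncard_smul_set]⟩

theorem isAmenable_of_forall_isAmenable_closure [Group G]
    (h : ∀ s : Finset G, IsAmenable (Subgroup.closure (s : Set G))) : IsAmenable G := by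
  choose ν hν using fun s => isAmenableAction_iff_exists_isInvariantMean.1 (h s)
  refine isAmenableAction_of_eventually_invariant atTop
    (fun s => (hν s).map (Subtype.val : Subgroup.closure (s : Set G) → G)) fun g A => ?_
  filter_upwards [mem_atTop {g}] with s hs
  have hg : g ∈ Subgroup.closure (s : Set G) :=
    Subgroup.subset_closure (hs (Finset.mem_singleton_self g))
  have hpre : ((↑) : Subgroup.closure (s : Set G) → G) ⁻¹' (g • A) =
      (⟨g, hg⟩ : Subgroup.closure (s : Set G)) • (↑) ⁻¹' A := by
    ext x
    simp only [mem_preimage, mem_smul_set_iff_inv_smul_mem]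
    rfl
  rw [hpre, (hν s).smul]

end Mean

section Algebraic

variable {n R S : Type*} [Fintype n] [DecidableEq n] [CommRing R] [CommRing S]

theorem mem_range_map_of_forall_mem_range {f : R →+* S} (hf : Function.Injective f)
    {g : Matrix.SpecialLinearGroup n S} (hg : ∀ i j, g i j ∈ f.range) :
    g ∈ (Matrix.SpecialLinearGroup.map (n := n) f).range := by
  choose m hm using hg
  have hmg : f.mapMatrix (.of m) = g.1 := Matrix.ext hm
  refine ⟨⟨.of m, hf ?_⟩, Subtype.ext hmg⟩
  rw [RingHom.map_det, hmg, g.2, map_one]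

theorem finite_closure_specialLinearGroup (F : Type*) {K : Type*} [Field F] [Finite F] [Field K]
    [Algebra F K] [Algebra.IsAlgebraic F K] (s : Finset (Matrix.SpecialLinearGroup n K)) :
    Finite (Subgroup.closure (s : Set (Matrix.SpecialLinearGroup n K))) := by
  let E : Set K := ⋃ g ∈ s, range fun ij : n × n => g ij.1 ij.2
  let M : IntermediateField F K := IntermediateField.adjoin F E
  have : Finite E := s.finite_toSet.biUnion fun g _ => finite_range _
  have : FiniteDimensional F M :=
    IntermediateField.finiteDimensional_adjoin fun x _ => Algebra.IsIntegral.isIntegral x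
  have : Finite M := Module.finite_of_finite F
  let φ := Matrix.SpecialLinearGroup.map (n := n) (algebraMap M K)
  have hle : Subgroup.closure (s : Set (Matrix.SpecialLinearGroup n K)) ≤ φ.range := by
    refine (Subgroup.closure_le _).2 fun g hg =>
      mem_range_map_of_forall_mem_range (algebraMap M K).injective fun i j => ?_
    have hmem : g i j ∈ M := IntermediateField.subset_adjoin F E (mem_biUnion hg ⟨(i, j), rfl⟩)
    exact ⟨⟨g i j, hmem⟩, rfl⟩
  exact (finite_range φ).subset hle

theorem isAmenable_specialLinearGroup_of_isAlgebraic (F K : Type*) [Field F] [Finite F] [Field K]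
    [Algebra F K] [Algebra.IsAlgebraic F K] :
    IsAmenable (Matrix.SpecialLinearGroup n K) :=
  isAmenable_of_forall_isAmenable_closure fun s =>
    have := finite_closure_specialLinearGroup F s
    isAmenable_of_finite

end Algebraic

section PingPong

open Filter MulAction
open scoped Pointwise

variable {G X : Type*} {μ : Set X → ℝ≥0}

theorem IsMean.empty (hμ : IsMean μ) : μ ∅ = 0 := by
  simpa using hμ.union ∅ ∅ (disjoint_empty _)

theorem IsMean.add_compl (hμ : IsMean μ) (A : Set X) : μ A + μ Aᶜ = 1 := by
  rw [← hμ.union _ _ disjoint_compl_right, union_compl_self, hμ.univ]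

theorem IsMean.union_eq_zero (hμ : IsMean μ) {A B : Set X} (hA : μ A = 0) (hB : μ B = 0) :
    μ (A ∪ B) = 0 := by
  have hdiff : μ (B \ A) = 0 := le_antisymm (hB ▸ hμ.mono sdiff_subset) zero_le
  rw [← union_sdiff_self, hμ.union _ _ disjoint_sdiff_right, hA, hdiff, add_zero]

/-- The filter of sets of full measure for a mean, the analogue of `MeasureTheory.ae`. -/
def IsMean.ae (hμ : IsMean μ) : Filter X :=
  comk (μ · = 0) hμ.empty (fun _ hB _ h => le_antisymm (hB ▸ hμ.mono h) zero_le)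
    fun _ hA _ hB => hμ.union_eq_zero hA hB

theorem IsMean.mem_ae (hμ : IsMean μ) {A : Set X} : A ∈ hμ.ae ↔ μ Aᶜ = 0 := Iff.rfl

instance IsMean.neBot_ae (hμ : IsMean μ) : hμ.ae.NeBot := by
  refine neBot_iff.2 fun h => zero_ne_one (α := ℝ≥0) ?_
  rw [← hμ.univ, ← compl_empty, hμ.mem_ae.1 (h ▸ mem_bot)]

variable [Group G] [MulAction G X]

theorem IsInvariantMean.eventually_of_smul (hμ : IsInvariantMean G μ) {p q : X → Prop}
    (hp : ∀ᶠ x in hμ.ae, p x) (g : G) (h : ∀ x, p x → q (g • x)) : ∀ᶠ x in hμ.ae, q x := by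
  have hsub : {x | q x}ᶜ ⊆ g • {x | p x}ᶜ := fun x hx =>
    mem_smul_set_iff_inv_smul_mem.2 fun hpx => hx <| smul_inv_smul g x ▸ h _ hpx
  refine hμ.mem_ae.2 (le_antisymm ?_ zero_le)
  calc μ {x | q x}ᶜ ≤ μ (g • {x | p x}ᶜ) := hμ.mono hsub
    _ = μ {x | p x}ᶜ := hμ.smul g _
    _ = 0 := hp

theorem IsInvariantMean.union_mem_ae (hμ : IsInvariantMean G μ) {A B : Set X}
    (hAB : Disjoint A B) {g : G} (h : g • Aᶜ ⊆ B) : A ∪ B ∈ hμ.ae := by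
  have hone : 1 ≤ μ (A ∪ B) := calc
    1 = μ A + μ (g • Aᶜ) := by rw [hμ.smul, hμ.add_compl]
    _ ≤ μ A + μ B := by gcongr; exact hμ.mono h
    _ = μ (A ∪ B) := (hμ.union A B hAB).symm
  refine hμ.mem_ae.2 (le_antisymm ?_ zero_le)
  rw [← add_le_add_iff_left (μ (A ∪ B)), hμ.add_compl, add_zero]
  exact hone

variable {Ω ι : Type*} [MulAction G Ω] {D E : Set Ω}

theorem smul_mem_fixedBy_conjAct_smul_iff (g : ConjAct G) (x : G) (ω : Ω) :
    ω ∈ fixedBy Ω (g • x) ↔ (ConjAct.ofConjAct g)⁻¹ • ω ∈ fixedBy Ω x := by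
  rw [ConjAct.smul_def, mem_fixedBy, mem_fixedBy, mul_smul, mul_smul, smul_eq_iff_eq_inv_smul]

theorem fixedBy_inter_nonempty_conj {x : G} (hx : (fixedBy Ω x ∩ D).Nonempty) (g : G)
    (hg : g • D ⊆ E) : (fixedBy Ω (ConjAct.toConjAct g • x) ∩ E).Nonempty := by
  obtain ⟨ω, hω, hD⟩ := hx
  refine ⟨g • ω, ?_, hg (smul_mem_smul_set hD)⟩
  rwa [smul_mem_fixedBy_conjAct_smul_iff, ConjAct.ofConjAct_toConjAct, inv_smul_smul]

theorem card_le_encard_fixedBy {u : ι → G} (hu : Pairwise fun i j => Disjoint (u i • D) (u j • D))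
    {x : G} (hx : ∀ i, (fixedBy Ω x ∩ u i • D).Nonempty) : ENat.card ι ≤ (fixedBy Ω x).encard := by
  choose f hfix hf using hx
  refine ENat.card_le_card_of_injective (f := fun i => (⟨f i, hfix i⟩ : fixedBy Ω x)) ?_
  intro i j hij
  by_contra hne
  exact (hu hne).ne_of_mem (hf i) (hf j) (congrArg Subtype.val hij)

theorem IsInvariantMean.eventually_fixedBy_inter_nonempty_or
    {μ : Set (nontrivialElements G) → ℝ≥0} (hμ : IsInvariantMean (ConjAct G) μ)
    (hfix : ∀ x : G, (fixedBy Ω x).Nonempty) (hDE : Disjoint D E) {h : G} (hh : h • Dᶜ ⊆ E) :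
    ∀ᶠ x in hμ.ae, (fixedBy Ω x.1 ∩ D).Nonempty ∨ (fixedBy Ω x.1 ∩ E).Nonempty := by
  let A : Set (nontrivialElements G) := {x | (fixedBy Ω x.1 ∩ D).Nonempty}
  let B : Set (nontrivialElements G) := {x | fixedBy Ω x.1 ⊆ E}
  have hAB : Disjoint A B :=
    disjoint_left.2 fun x ⟨ω, hω, hD⟩ hE => hDE.ne_of_mem hD (hE hω) rfl
  have hA : ConjAct.toConjAct h • Aᶜ ⊆ B := by
    rintro _ ⟨x, hx, rfl⟩ ω hω
    rw [← smul_inv_smul h ω]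
    exact hh (smul_mem_smul_set fun hD =>
      hx ⟨_, (smul_mem_fixedBy_conjAct_smul_iff _ _ _).1 hω, hD⟩)
  filter_upwards [hμ.union_mem_ae hAB hA] with x hx
  exact hx.imp_right fun hE => (hfix x.1).mono fun ω hω => ⟨hω, hE hω⟩

theorem not_isInnerAmenable_of_pingPong [Finite ι]
    (hfix : ∀ x : G, (fixedBy Ω x).Nonempty)
    (hcard : ∀ x : G, x ≠ 1 → (fixedBy Ω x).encard < ENat.card ι)
    (hDE : Disjoint D E) {h w : G} {u : ι → G} (hh : h • Dᶜ ⊆ E) (hw : w • E ⊆ D)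
    (huD : Pairwise fun i j => Disjoint (u i • D) (u j • D)) (huE : ∀ i, u i • E ⊆ E) :
    ¬ IsInnerAmenable G := by
  intro hG
  obtain ⟨μ, hμ⟩ := isAmenableAction_iff_exists_isInvariantMean.1 hG
  have hnot (x : nontrivialElements G) : ¬ ∀ i, (fixedBy Ω x.1 ∩ u i • D).Nonempty := fun hx =>
    (card_le_encard_fixedBy huD hx).not_gt (hcard x x.2)
  have hDorE := hμ.eventually_fixedBy_inter_nonempty_or hfix hDE hh
  have huDorE (i) :
      ∀ᶠ x in hμ.ae, (fixedBy Ω x.1 ∩ u i • D).Nonempty ∨ (fixedBy Ω x.1 ∩ E).Nonempty :=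
    hμ.eventually_of_smul hDorE (ConjAct.toConjAct (u i)) fun x hx => hx.imp
      (fixedBy_inter_nonempty_conj · _ subset_rfl) (fixedBy_inter_nonempty_conj · _ (huE i))
  have hE : ∀ᶠ x in hμ.ae, (fixedBy Ω x.1 ∩ E).Nonempty := by
    filter_upwards [eventually_all.2 huDorE] with x hx
    by_contra hxE
    exact hnot x fun i => (hx i).resolve_right hxE
  have hD : ∀ᶠ x in hμ.ae, (fixedBy Ω x.1 ∩ D).Nonempty :=
    hμ.eventually_of_smul hE (ConjAct.toConjAct w) fun x hx => fixedBy_inter_nonempty_conj hx _ hw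
  have huD' (i) : ∀ᶠ x in hμ.ae, (fixedBy Ω x.1 ∩ u i • D).Nonempty :=
    hμ.eventually_of_smul hD (ConjAct.toConjAct (u i)) fun x hx =>
      fixedBy_inter_nonempty_conj hx _ subset_rfl
  obtain ⟨x, hx⟩ := (eventually_all.2 huD').exists
  exact hnot x hx

end PingPong

section ProjectiveLine

open Matrix MulAction OnePoint Polynomial

variable {K : Type*} [Field K]

theorem encard_image_coe_rootSet_le (P : K[X]) :
    ((↑) '' P.rootSet K : Set (OnePoint K)).encard ≤ P.natDegree := by
  rw [coe_injective.encard_image, ← (rootSet_finite P K).cast_ncard_eq]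
  exact_mod_cast ncard_rootSet_le P K

variable [DecidableEq K]

/-- The action of `SL(2, K)` on the projective line by Möbius transformations. -/
instance instMulActionSLOnePoint : MulAction SL(2, K) (OnePoint K) :=
  .compHom _ Matrix.SpecialLinearGroup.toGL

theorem sl_smul_infty (g : SL(2, K)) :
    g • (∞ : OnePoint K) = if g 1 0 = 0 then ∞ else ↑(g 0 0 / g 1 0) :=
  smul_infty_eq_ite (Matrix.SpecialLinearGroup.toGL g)

theorem sl_smul_coe (g : SL(2, K)) (z : K) :
    g • (z : OnePoint K) =
      if g 1 0 * z + g 1 1 = 0 then ∞ else ↑((g 0 0 * z + g 0 1) / (g 1 0 * z + g 1 1)) :=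
  smul_some_eq_ite (g := Matrix.SpecialLinearGroup.toGL g)

theorem fixedBy_onePoint_nonempty [IsAlgClosed K] (g : GL (Fin 2) K) :
    (fixedBy (OnePoint K) g).Nonempty := by
  by_cases hc : g 1 0 = 0
  · exact ⟨∞, smul_infty_eq_self_iff.2 hc⟩
  · have hdeg : g.fixpointPolynomial.degree ≠ 0 := by
      rw [GeneralLinearGroup.fixpointPolynomial, sub_eq_add_neg, ← C_neg, degree_quadratic hc]
      decide
    obtain ⟨z, hz⟩ := IsAlgClosed.exists_root _ hdeg
    exact ⟨z, GeneralLinearGroup.fixpointPolynomial_aeval_eq_zero_iff.1 (by simpa using hz)⟩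

theorem encard_fixedBy_onePoint_le_two {g : GL (Fin 2) K} (hg : g.1 ∉ range (scalar (Fin 2))) :
    (fixedBy (OnePoint K) g).encard ≤ 2 := by
  have hP : g.fixpointPolynomial ≠ 0 := GeneralLinearGroup.fixpointPolynomial_eq_zero_iff.not.2 hg
  have hroot {z : K} (hz : (z : OnePoint K) ∈ fixedBy (OnePoint K) g) :
      z ∈ g.fixpointPolynomial.rootSet K :=
    (mem_rootSet_of_ne hP).2 (GeneralLinearGroup.fixpointPolynomial_aeval_eq_zero_iff.2 hz)
  have hle := encard_image_coe_rootSet_le g.fixpointPolynomial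
  by_cases hc : g 1 0 = 0
  · have hdeg : g.fixpointPolynomial.natDegree ≤ 1 := by
      rw [GeneralLinearGroup.fixpointPolynomial, hc, C_0, zero_mul, zero_add]
      compute_degree
    have hsub : fixedBy (OnePoint K) g ⊆ insert ∞ ((↑) '' g.fixpointPolynomial.rootSet K) := by
      intro x hx
      induction x with
      | infty => exact mem_insert _ _
      | coe z => exact mem_insert_of_mem _ (mem_image_of_mem _ (hroot hx))
    calc (fixedBy (OnePoint K) g).encard
      _ ≤ ((↑) '' g.fixpointPolynomial.rootSet K : Set (OnePoint K)).encard + 1 :=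
        (encard_le_encard hsub).trans (encard_insert_le _ _)
      _ ≤ 1 + 1 := by gcongr; exact hle.trans (by exact_mod_cast hdeg)
      _ = 2 := one_add_one_eq_two
  · have hdeg : g.fixpointPolynomial.natDegree ≤ 2 := by
      rw [GeneralLinearGroup.fixpointPolynomial]
      compute_degree
    have hsub : fixedBy (OnePoint K) g ⊆ (↑) '' g.fixpointPolynomial.rootSet K := by
      intro x hx
      induction x with
      | infty => exact (hc (smul_infty_eq_self_iff.1 hx)).elim
      | coe z => exact mem_image_of_mem _ (hroot hx)
    exact (encard_le_encard hsub).trans (hle.trans (by exact_mod_cast hdeg))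

theorem encard_fixedBy_onePoint_le_two_of_notMem_center {g : SL(2, K)}
    (hg : g ∉ Subgroup.center SL(2, K)) : (fixedBy (OnePoint K) g).encard ≤ 2 :=
  encard_fixedBy_onePoint_le_two (g := Matrix.SpecialLinearGroup.toGL g)
    (mem_center_specialLinearGroup_iff_mem_range_scalar.not.1 hg)

end ProjectiveLine

section Valuation

open Matrix MulAction OnePoint Matrix.SpecialLinearGroup
open scoped Pointwise

variable {L Γ : Type*} [Field L] [LinearOrderedCommGroupWithZero Γ] (v : Valuation L Γ)

/-- The open unit disc of a valuation, as a subset of the projective line. -/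
def openUnitDisc : Set (OnePoint L) :=
  (↑) '' {z : L | v z < 1}

/-- The complement of the closed unit disc of a valuation: the open unit disc about infinity. -/
def openDiscAtInfty : Set (OnePoint L) :=
  insert ∞ ((↑) '' {z : L | 1 < v z})

theorem coe_mem_openUnitDisc {z : L} : (z : OnePoint L) ∈ openUnitDisc v ↔ v z < 1 := by
  simp [openUnitDisc]

theorem infty_mem_openDiscAtInfty : ∞ ∈ openDiscAtInfty v :=
  mem_insert _ _

theorem coe_mem_openDiscAtInfty {z : L} : (z : OnePoint L) ∈ openDiscAtInfty v ↔ 1 < v z := by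
  simp [openDiscAtInfty]

theorem disjoint_openUnitDisc_openDiscAtInfty :
    Disjoint (openUnitDisc v) (openDiscAtInfty v) := by
  refine disjoint_left.2 ?_
  rintro _ ⟨z, hz, rfl⟩ h
  exact lt_asymm hz ((coe_mem_openDiscAtInfty v).1 h)

variable (L) in
/-- The matrix of the inversion `z ↦ -1 / z` of the projective line, which moves the disc about
infinity into the unit disc. -/
def inversion : SL(2, L) := ⟨!![0, -1; 1, 0], by simp⟩

variable [DecidableEq L]

theorem diag2_smul_infty {t : L} (ht : t ≠ 0) : diag2 t ht • (∞ : OnePoint L) = ∞ := by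
  rw [sl_smul_infty, if_pos (by simp [diag2_coe'])]

theorem diag2_smul_coe {t : L} (ht : t ≠ 0) (z : L) :
    diag2 t ht • (z : OnePoint L) = ↑(t ^ 2 * z) := by
  rw [sl_smul_coe, diag2_coe']
  simp [ht, pow_two, mul_right_comm]

theorem transvection_smul_infty (a : L) :
    (transvection zero_ne_one a : SL(2, L)) • (∞ : OnePoint L) = ∞ := by
  rw [sl_smul_infty, if_pos (by simp [transvection_coe])]

theorem transvection_smul_coe (a z : L) :
    (transvection zero_ne_one a : SL(2, L)) • (z : OnePoint L) = ↑(z + a) := by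
  simp [sl_smul_coe, transvection_coe]

theorem inversion_smul_infty : inversion L • (∞ : OnePoint L) = ↑(0 : L) := by
  rw [sl_smul_infty]
  simp [inversion]

theorem inversion_smul_coe {z : L} (hz : z ≠ 0) :
    inversion L • (z : OnePoint L) = ↑(-z⁻¹) := by
  rw [sl_smul_coe]
  simp [inversion, hz, neg_div]

theorem inversion_smul_openDiscAtInfty_subset :
    inversion L • openDiscAtInfty v ⊆ openUnitDisc v := by
  rintro _ ⟨x, hx, rfl⟩
  induction x with
  | infty => simp [inversion_smul_infty, coe_mem_openUnitDisc]
  | coe z =>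
    rw [coe_mem_openDiscAtInfty] at hx
    have hz : z ≠ 0 := v.ne_zero_iff.1 (zero_lt_one.trans hx).ne'
    simpa only [inversion_smul_coe hz, coe_mem_openUnitDisc, Valuation.map_neg, map_inv₀] using
      inv_lt_one_of_one_lt₀ hx

theorem diag2_smul_compl_openUnitDisc_subset {t : L} (ht : t ≠ 0) (hvt : 1 < v t) :
    diag2 t ht • (openUnitDisc v)ᶜ ⊆ openDiscAtInfty v := by
  rintro _ ⟨x, hx, rfl⟩
  induction x with
  | infty => simpa only [diag2_smul_infty] using infty_mem_openDiscAtInfty v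
  | coe z =>
    simp only [diag2_smul_coe, coe_mem_openDiscAtInfty, map_mul, map_pow]
    rw [mem_compl_iff, coe_mem_openUnitDisc, not_lt] at hx
    exact one_lt_mul_of_lt_of_le (one_lt_pow₀ hvt two_ne_zero) hx

theorem transvection_smul_openDiscAtInfty_subset {a : L} (ha : v a ≤ 1) :
    (transvection zero_ne_one a : SL(2, L)) • openDiscAtInfty v ⊆ openDiscAtInfty v := by
  rintro _ ⟨x, hx, rfl⟩
  induction x with
  | infty => simpa only [transvection_smul_infty] using hx
  | coe z =>
    rw [coe_mem_openDiscAtInfty] at hx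
    simp only [transvection_smul_coe, coe_mem_openDiscAtInfty]
    rwa [v.map_add_eq_of_lt_left (ha.trans_lt hx)]

theorem disjoint_transvection_smul_openUnitDisc {a b : L} (hab : v (a - b) = 1) :
    Disjoint ((transvection zero_ne_one a : SL(2, L)) • openUnitDisc v)
      ((transvection zero_ne_one b : SL(2, L)) • openUnitDisc v) := by
  rw [disjoint_left]
  rintro _ ⟨_, ⟨z, hz, rfl⟩, rfl⟩ ⟨_, ⟨w, hw, rfl⟩, h⟩
  simp only [transvection_smul_coe, coe_eq_coe] at h
  refine (v.map_sub_lt hw hz).ne ?_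
  rw [← hab, show a - b = w - z by linear_combination -h]
omit [DecidableEq L] in
theorem not_isInnerAmenable_of_one_lt_valuation [IsAlgClosed L] (F : Type*) [Field F] [Finite F]
    [Algebra F L] (hF : 2 < ENat.card F) (hcenter : Subgroup.center SL(2, L) = ⊥) {t : L}
    (ht : 1 < v t) : ¬ IsInnerAmenable SL(2, L) := by
  classical
  have ht0 : t ≠ 0 := v.ne_zero_iff.1 (zero_lt_one.trans ht).ne'
  refine not_isInnerAmenable_of_pingPong (Ω := OnePoint L) (ι := F)
    (u := fun a => transvection zero_ne_one (algebraMap F L a))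
    (fun x => fixedBy_onePoint_nonempty (toGL x))
    (fun x hx => hF.trans_le' (encard_fixedBy_onePoint_le_two_of_notMem_center
      (by rwa [hcenter, Subgroup.mem_bot])))
    (disjoint_openUnitDisc_openDiscAtInfty v) (diag2_smul_compl_openUnitDisc_subset v ht0 ht)
    (inversion_smul_openDiscAtInfty_subset v) (fun a b hab => ?_) fun a => ?_
  · refine disjoint_transvection_smul_openUnitDisc v ?_
    rw [← map_sub]
    exact FiniteField.valuation_algebraMap_eq_one v (a - b) (sub_ne_zero.2 hab)
  · exact transvection_smul_openDiscAtInfty_subset v (FiniteField.valuation_algebraMap_le_one v a)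

end Valuation

theorem exists_one_lt_valuation (F L : Type*) [Field F] [Field L] [Algebra F L]
    [h : Algebra.Transcendental F L] :
    ∃ (V : ValuationSubring L) (t : L), 1 < V.valuation t := by
  obtain ⟨t, ht⟩ := h.transcendental
  let R : Subring L := (integralClosure F L).toSubring
  have hR : t ∉ R := fun h => ht (isAlgebraic_iff_isIntegral.2 h)
  have : IsIntegrallyClosedIn R L :=
    inferInstanceAs (IsIntegrallyClosedIn (integralClosure F L) L)
  obtain ⟨V, -, hV⟩ := Subring.exists_le_valuationSubring_of_isIntegrallyClosedIn hR
  exact ⟨V, t, not_le.1 fun h => hV ((V.valuation_le_one_iff t).1 h)⟩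

theorem countable_specialLinearGroup (n R : Type*) [Fintype n] [DecidableEq n] [CommRing R]
    [Countable R] : Countable (Matrix.SpecialLinearGroup n R) :=
  have : Countable (Matrix n n R) := inferInstanceAs (Countable (n → n → R))
  Subtype.countable

theorem countable_of_isAlgebraic (F K : Type*) [Field F] [Countable F] [Field K] [Algebra F K]
    [Algebra.IsAlgebraic F K] : Countable K := by
  rw [← Cardinal.mk_le_aleph0_iff, ← Cardinal.lift_le_aleph0]
  refine (Algebra.IsAlgebraic.lift_cardinalMk_le_max F K).trans ?_
  simp

theorem countable_ratFunc (F : Type*) [Field F] [Countable F] : Countable (RatFunc F) := by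
  rw [← Cardinal.mk_le_aleph0_iff, IsFractionRing.cardinalMk (Polynomial F)]
  exact Polynomial.cardinalMk_le_max.trans (by simp)

theorem trdeg_algebraicClosure_ratFunc_pos (F : Type*) [Field F] :
    0 < Algebra.trdeg F (AlgebraicClosure (RatFunc F)) := by
  have : Algebra.Transcendental F (AlgebraicClosure (RatFunc F)) :=
    ⟨algebraMap (RatFunc F) _ RatFunc.X,
      (transcendental_algebraMap_iff (FaithfulSMul.algebraMap_injective _ _)).2
        RatFunc.transcendental_X⟩
  exact trdeg_pos _ _

section CharTwo

variable (L : Type*) [Field L] [CharP L 2]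

theorem center_SL_two_eq_bot : Subgroup.center SL(2, L) = ⊥ :=
  center_specialLinearGroup_eq_bot 2 1 (by simp)

theorem isICC_SL_two [Infinite L] : IsICC SL(2, L) :=
  isICC_specialLinearGroup (center_SL_two_eq_bot L)

theorem not_isInnerAmenable_SL_two [IsAlgClosed L] [Algebra (ZMod 2) L]
    (hL : 0 < Algebra.trdeg (ZMod 2) L) : ¬ IsInnerAmenable SL(2, L) := by
  have : Algebra.Transcendental (ZMod 2) L := trdeg_ne_zero_iff.1 hL.ne'
  obtain ⟨V, t, ht⟩ := exists_one_lt_valuation (ZMod 2) L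
  let F := GaloisField 2 2
  have hF : 2 < ENat.card F := by
    rw [ENat.card_eq_coe_natCard, GaloisField.card 2 2 two_ne_zero]
    decide
  let f : F →ₐ[ZMod 2] L := IsAlgClosed.lift
  let : Algebra F L := f.toRingHom.toAlgebra
  exact not_isInnerAmenable_of_one_lt_valuation V.valuation F hF (center_SL_two_eq_bot L) ht

end CharTwo

theorem theorem1 :
    -- There are elementarily equivalent countable ICC groups, one amenable, one not inner amenable.
    (∃ (G H : Type) (_ : Group G) (_ : Group H),
      Countable G ∧ Countable H ∧ IsICC G ∧ IsICC H ∧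
      (G ≅[groupLanguage] H) ∧ IsAmenable G ∧ ¬ IsInnerAmenable H) ∧
    -- Concretely, one may take `G = SL₂(K)` with `K` the algebraic closure of `𝔽₂`, ...
    (Countable SL(2, AlgebraicClosure (ZMod 2)) ∧ IsICC SL(2, AlgebraicClosure (ZMod 2)) ∧
      IsAmenable SL(2, AlgebraicClosure (ZMod 2))) ∧
    -- ... and `H = SL₂(L)` with `L` algebraically closed of characteristic 2 and positive
    -- transcendence degree (over the prime field), countable if `H` is to be countable, ...
    (∀ (L : Type*) [Field L] [IsAlgClosed L] [CharP L 2] [Algebra (ZMod 2) L],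
      0 < Algebra.trdeg (ZMod 2) L →
        (Countable L → Countable SL(2, L)) ∧ IsICC SL(2, L) ∧
        (SL(2, AlgebraicClosure (ZMod 2)) ≅[groupLanguage] SL(2, L)) ∧
        ¬ IsInnerAmenable SL(2, L)) ∧
    -- ... for example `L` the algebraic closure of `𝔽₂(t)`.
    (Countable (AlgebraicClosure (RatFunc (ZMod 2))) ∧
      IsAlgClosed (AlgebraicClosure (RatFunc (ZMod 2))) ∧
      CharP (AlgebraicClosure (RatFunc (ZMod 2))) 2 ∧
      0 < Algebra.trdeg (ZMod 2) (AlgebraicClosure (RatFunc (ZMod 2)))) := by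
  have := countable_of_isAlgebraic (ZMod 2) (AlgebraicClosure (ZMod 2))
  have := countable_ratFunc (ZMod 2)
  have hL := countable_of_isAlgebraic (RatFunc (ZMod 2)) (AlgebraicClosure (RatFunc (ZMod 2)))
  have htrdeg := trdeg_algebraicClosure_ratFunc_pos (ZMod 2)
  have hG : IsAmenable SL(2, AlgebraicClosure (ZMod 2)) :=
    isAmenable_specialLinearGroup_of_isAlgebraic (ZMod 2) _
  refine ⟨⟨SL(2, AlgebraicClosure (ZMod 2)), SL(2, AlgebraicClosure (RatFunc (ZMod 2))),
      inferInstance, inferInstance, countable_specialLinearGroup _ _,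
      countable_specialLinearGroup _ _, isICC_SL_two _, isICC_SL_two _,
      elementarilyEquivalent_specialLinearGroup_of_isAlgClosed _ (.inl Nat.prime_two) _ _, hG,
      not_isInnerAmenable_SL_two _ htrdeg⟩,
    ⟨countable_specialLinearGroup _ _, isICC_SL_two _, hG⟩, ?_, hL, inferInstance, inferInstance,
    htrdeg⟩
  intro L _ _ _ _ htrdegL
  exact ⟨fun _ => countable_specialLinearGroup _ _, isICC_SL_two L,
    elementarilyEquivalent_specialLinearGroup_of_isAlgClosed _ (.inl Nat.prime_two) _ L,
    not_isInnerAmenable_SL_two L htrdegL⟩
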